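/- An $L$-algebra is a set $X$ with a binary operation $\cdot$ and an element $1\in X$ such that, for all $x,y,z\in X$, $x\cdot x=x\cdot 1=1$, $1\cdot x=x$, $(x\cdot y)\cdot(x\cdot z)=(y\cdot x)\cdot(y\cdot z)$, and $x\cdot y=y\cdot x=1$ implies $x=y$. It is partially ordered by $x\le y:\Leftrightarrow x\cdot y=1$. An ideal of $X$ is a subset $I\ni 1$ such that, for all $x,y\in X$, $x\in I$ and $x\cdot y\in I$ imply $y\in I$, and $x\in I$ implies that $(x\cdot y)\cdot y$, $y\cdot x$ and $y\cdot(x\cdot y)$ belong to $I$. The ideals form a complete lattice under inclusion; $I\vee J$ denotes the join of two ideals and $\langle x\rangle$ the ideal generated by $x$. For ideals $I,J$ put $I\cdot J:=\{x\in X\mid\langle x\rangle\cap I\subseteq J\}$. An ideal $P\ne X$ is prime if every ideal $I$ satisfies $I\subseteq P$ or $I\cdot P\subseteq P$. An element $p<1$ of $X$ is prime if every $x\in X$ satisfies $x\le p$ or $x\cdot p\le p$. An element $q<1$ of $X$ is quasi-prime if, for all ideals $I,J$ of $X$, $q\in I\vee J$ implies $q\in I$ or $q\in J$. **Proposition.**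 Every prime element $p$ of an $L$-algebra $X$ is quasi-prime. Hence $p$ determines a prime ideal $P_p$: there is exactly one ideal $P_p$ that is maximal among the ideals of $X$ not containing $p$, and $P_p$ is prime. -/

import Mathlib

universe u

/-- An L-algebra: a set with a binary operation (written `x ⊳ y` below) and a logical unit `1`. -/
class LAlgebra (X : Type u) extends One X where
  /-- the operation of the L-algebra -/
  op : X → X → X
  op_self : ∀ x : X, op x x = 1
  op_one : ∀ x : X, op x 1 = 1
  one_op : ∀ x : X, op 1 x = x
  op_op : ∀ x y z : X, op (op x y) (op x z) = op (op y x) (op y z)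
  op_antisymm : ∀ x y : X, op x y = 1 → op y x = 1 → x = y

infixr:70 " ⊳ " => LAlgebra.op

namespace LAlgebra

/-- The natural partial order of an L-algebra: `x ≤ y` means `x ⊳ y = 1`. -/
instance (X : Type u) [LAlgebra X] : PartialOrder X where
  le x y := x ⊳ y = 1
  le_refl x := op_self x
  le_trans x y z hxy hyz := by
    have h := op_op x y z
    rw [hxy, hyz, op_one, one_op] at h
    exact h
  le_antisymm x y := op_antisymm x y

theorem le_def {X : Type u} [LAlgebra X] {x y : X} : x ≤ y ↔ x ⊳ y = 1 := Iff.rfl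

/-- Prime elements of an L-algebra. -/
def IsPrimeElement {X : Type u} [LAlgebra X] (p : X) : Prop :=
  p < 1 ∧ ∀ x : X, x ≤ p ∨ x ⊳ p ≤ p

end LAlgebra

/-- Ideals of an L-algebra. -/
structure LIdeal (X : Type u) [LAlgebra X] where
  /-- the underlying set -/
  carrier : Set X
  one_mem' : 1 ∈ carrier
  mem_of_op_mem' : ∀ {x y : X}, x ∈ carrier → x ⊳ y ∈ carrier → y ∈ carrier
  op_op_mem' : ∀ {x : X} (y : X), x ∈ carrier → (x ⊳ y) ⊳ y ∈ carrier
  op_mem' : ∀ {x : X} (y : X), x ∈ carrier → y ⊳ x ∈ carrier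
  op_op_mem_left' : ∀ {x : X} (y : X), x ∈ carrier → y ⊳ (x ⊳ y) ∈ carrier

namespace LIdeal

variable {X : Type u} [LAlgebra X]

instance : SetLike (LIdeal X) X where
  coe := carrier
  coe_injective I J h := by cases I; cases J; congr

/-- Ideals are ordered by inclusion. -/
instance : PartialOrder (LIdeal X) := .ofSetLike (LIdeal X) X

/-- The infimum of a set of ideals is the intersection. -/
instance : InfSet (LIdeal X) where
  sInf S :=
    { carrier := {x | ∀ I ∈ S, x ∈ I}
      one_mem' := fun I _ => I.one_mem'
      mem_of_op_mem' := fun hx hxy I hI => I.mem_of_op_mem' (hx I hI) (hxy I hI)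
      op_op_mem' := fun y hx I hI => I.op_op_mem' y (hx I hI)
      op_mem' := fun y hx I hI => I.op_mem' y (hx I hI)
      op_op_mem_left' := fun y hx I hI => I.op_op_mem_left' y (hx I hI) }

/-- The complete lattice of ideals. In particular `I ⊔ J` is the least ideal containing
`I` and `J`. -/
instance : CompleteLattice (LIdeal X) where
  __ := completeLatticeOfInf (LIdeal X) fun _ =>
    ⟨fun _ hI _ hx => hx _ hI, fun _ hJ _ hx _ hI => hJ hI hx⟩
  inf I J :=
    { carrier := {x | x ∈ I ∧ x ∈ J}
      one_mem' := ⟨I.one_mem', J.one_mem'⟩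
      mem_of_op_mem' := fun hx hxy =>
        ⟨I.mem_of_op_mem' hx.1 hxy.1, J.mem_of_op_mem' hx.2 hxy.2⟩
      op_op_mem' := fun y hx => ⟨I.op_op_mem' y hx.1, J.op_op_mem' y hx.2⟩
      op_mem' := fun y hx => ⟨I.op_mem' y hx.1, J.op_mem' y hx.2⟩
      op_op_mem_left' := fun y hx => ⟨I.op_op_mem_left' y hx.1, J.op_op_mem_left' y hx.2⟩ }
  inf_le_left _ _ _ hx := hx.1
  inf_le_right _ _ _ hx := hx.2
  le_inf _ _ _ h₁ h₂ _ hx := ⟨h₁ hx, h₂ hx⟩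
  top :=
    { carrier := Set.univ
      one_mem' := trivial
      mem_of_op_mem' := fun _ _ => trivial
      op_op_mem' := fun _ _ => trivial
      op_mem' := fun _ _ => trivial
      op_op_mem_left' := fun _ _ => trivial }
  le_top _ _ _ := trivial

/-- The ideal generated by an element. -/
def span (x : X) : LIdeal X := sInf {I | x ∈ I}

/-- The operation `I · J` on ideals: all `x` such that `⟨x⟩ ∩ I ⊆ J`. -/
def residual (I J : LIdeal X) : Set X := {x | span x ⊓ I ≤ J}

/-- Prime ideals, that is, prime elements of the lattice of ideals with the operation
`(I, J) ↦ I · J`: proper ideals `P` such that every ideal `I` satisfies `I ⊆ P` or `I · P ⊆ P`. -/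
def IsPrime (P : LIdeal X) : Prop :=
  P < ⊤ ∧ ∀ I : LIdeal X, I ≤ P ∨ residual I P ⊆ (P : Set X)

end LIdeal

/-- Quasi-prime elements of an L-algebra. -/
def LAlgebra.IsQuasiPrime {X : Type u} [LAlgebra X] (q : X) : Prop :=
  q < 1 ∧ ∀ I J : LIdeal X, q ∈ I ⊔ J → q ∈ I ∨ q ∈ J

/-- `P` is maximal among the ideals that do not contain `x`. -/
def LIdeal.IsMaximalAvoiding {X : Type u} [LAlgebra X] (x : X) (P : LIdeal X) : Prop :=
  Maximal (fun I : LIdeal X => x ∉ I) P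

/-! Each ideal `I` induces a congruence `Rel`. An element of `I ⊔ J` is joined to `1` by a finite
zigzag of `I`- and `J`-related pairs (`eqvGen_of_mem_sup`). If a prime `p` lies outside an ideal,
the down-set of `p` is saturated for its congruence (`Rel.le_of_le`); so if `p ∈ I ⊔ J` lay in
neither ideal, the zigzag would give `1 ≤ p`. For quasi-prime `q` and `P` maximal avoiding `q`,
every ideal not below `P` contains `q` (`mem_of_not_le`); uniqueness and primality of `P` follow,
and Zorn gives existence. -/

namespace LIdeal

variable {X : Type u} [LAlgebra X]

open LAlgebra

/-- The congruence of an ideal: `x` and `y` are related if `x ⊳ y` and `y ⊳ x` lie in `I`. -/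
def Rel (I : LIdeal X) (x y : X) : Prop := x ⊳ y ∈ I ∧ y ⊳ x ∈ I

theorem Rel.symm {I : LIdeal X} {x y : X} (h : I.Rel x y) : I.Rel y x := ⟨h.2, h.1⟩

theorem op_mem_trans {I : LIdeal X} {x y z : X} (hxy : x ⊳ y ∈ I) (hyz : y ⊳ z ∈ I) :
    x ⊳ z ∈ I := by
  have h : (x ⊳ y) ⊳ (x ⊳ z) ∈ I := by
    rw [op_op]
    exact I.op_mem' _ hyz
  exact I.mem_of_op_mem' hxy h

theorem Rel.op_left {I : LIdeal X} {x y : X} (h : I.Rel x y) (z : X) :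
    I.Rel (z ⊳ x) (z ⊳ y) := by
  constructor
  · rw [op_op]
    exact I.op_mem' _ h.1
  · rw [op_op]
    exact I.op_mem' _ h.2

/-- The left factors `x ⊳ y` and then `y ⊳ x`, both in `I`, are inserted and removed modulo `I`,
with `op_op` exchanging one for the other. -/
theorem Rel.op_mem_right {I : LIdeal X} {x y : X} (h : I.Rel x y) (z : X) :
    (x ⊳ z) ⊳ (y ⊳ z) ∈ I := by
  have h₁ : (x ⊳ z) ⊳ ((x ⊳ y) ⊳ (x ⊳ z)) ∈ I := I.op_op_mem_left' _ h.1
  rw [op_op x y z] at h₁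
  exact op_mem_trans h₁ (I.op_op_mem' _ h.2)

theorem Rel.op_right {I : LIdeal X} {x y : X} (h : I.Rel x y) (z : X) :
    I.Rel (x ⊳ z) (y ⊳ z) :=
  ⟨h.op_mem_right z, h.symm.op_mem_right z⟩

theorem rel_one {I : LIdeal X} {x : X} (hx : x ∈ I) : I.Rel x 1 := by
  refine ⟨?_, ?_⟩
  · rw [op_one]
    exact I.one_mem'
  · rwa [one_op]

/-- The class of `1` under an equivalence relation compatible with the operation. -/
def ofCongruence (r : X → X → Prop) (hr : Equivalence r)
    (hl : ∀ {x y : X} (z : X), r x y → r (z ⊳ x) (z ⊳ y))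
    (hr' : ∀ {x y : X} (z : X), r x y → r (x ⊳ z) (y ⊳ z)) : LIdeal X where
  carrier := {x | r x 1}
  one_mem' := hr.refl 1
  mem_of_op_mem' {x y} hx hxy := by
    have h := hr' y hx
    rw [one_op] at h
    exact hr.trans (hr.symm h) hxy
  op_op_mem' {x} y hx := by
    have h := hr' y (hr' y hx)
    rwa [one_op, op_self] at h
  op_mem' {x} y hx := by
    have h := hl y hx
    rwa [op_one] at h
  op_op_mem_left' {x} y hx := by
    have h := hl y (hr' y hx)
    rwa [one_op, op_self] at h

/-- The generated equivalence is again a congruence, so its class of `1` is an ideal, and it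
contains both `I` and `J`. -/
theorem eqvGen_of_mem_sup {I J : LIdeal X} {x : X} (hx : x ∈ I ⊔ J) :
    Relation.EqvGen (fun a b => I.Rel a b ∨ J.Rel a b) x 1 := by
  have map {f : X → X} (hf : ∀ (K : LIdeal X) {a b : X}, K.Rel a b → K.Rel (f a) (f b))
      {a b : X} (h : Relation.EqvGen (fun a b => I.Rel a b ∨ J.Rel a b) a b) :
      Relation.EqvGen (fun a b => I.Rel a b ∨ J.Rel a b) (f a) (f b) := by
    induction h with
    | rel a b h => exact .rel _ _ (h.imp (hf I) (hf J))
    | refl a => exact .refl _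
    | symm a b _ ih => exact .symm _ _ ih
    | trans a b c _ _ ih₁ ih₂ => exact .trans _ _ _ ih₁ ih₂
  have hle : I ⊔ J ≤ ofCongruence _ (Relation.EqvGen.is_equivalence _)
      (fun z => map fun _ _ _ h => h.op_left z) (fun z => map fun _ _ _ h => h.op_right z) :=
    sup_le (fun _ h => .rel _ _ (.inl (rel_one h))) (fun _ h => .rel _ _ (.inr (rel_one h)))
  exact hle hx

theorem mem_of_le {I : LIdeal X} {x y : X} (hx : x ∈ I) (h : x ≤ y) : y ∈ I :=
  I.mem_of_op_mem' hx (by rw [le_def.1 h]; exact I.one_mem')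

/-- Since `x ⊳ p = 1`, compatibility puts `y ⊳ p` in `I`; then `y ⊳ p ≤ p` would force `p ∈ I`, so
primality leaves `y ≤ p`. -/
theorem Rel.le_of_le {I : LIdeal X} {p x y : X} (hp : IsPrimeElement p) (hI : p ∉ I)
    (h : I.Rel x y) (hx : x ≤ p) : y ≤ p := by
  refine (hp.2 y).resolve_right fun hy => hI (mem_of_le ?_ hy)
  have h' := h.op_mem_right p
  rwa [le_def.1 hx, one_op] at h'

end LIdeal

namespace LAlgebra

variable {X : Type u} [LAlgebra X]

theorem IsPrimeElement.isQuasiPrime {p : X} (hp : IsPrimeElement p) : IsQuasiPrime p := by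
  refine ⟨hp.1, fun I J h => ?_⟩
  by_contra! hIJ
  have key {x y : X} (h : Relation.EqvGen (fun a b => I.Rel a b ∨ J.Rel a b) x y) :
      x ≤ p ↔ y ≤ p := by
    induction h with
    | rel a b h =>
      rcases h with h | h
      · exact ⟨h.le_of_le hp hIJ.1, h.symm.le_of_le hp hIJ.1⟩
      · exact ⟨h.le_of_le hp hIJ.2, h.symm.le_of_le hp hIJ.2⟩
    | refl a => exact Iff.rfl
    | symm a b _ ih => exact ih.symm
    | trans a b c _ _ ih₁ ih₂ => exact ih₁.trans ih₂
  exact hp.1.not_ge ((key (LIdeal.eqvGen_of_mem_sup h)).1 le_rfl)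

end LAlgebra

namespace LIdeal

variable {X : Type u} [LAlgebra X]

open LAlgebra

theorem mem_span_self (x : X) : x ∈ span x := fun _ h => h

/-- The union of a nonempty chain of ideals. -/
def chainUnion (c : Set (LIdeal X)) (hc : IsChain (· ≤ ·) c) (hne : c.Nonempty) : LIdeal X where
  carrier := {x | ∃ I ∈ c, x ∈ I}
  one_mem' := hne.imp fun I hI => ⟨hI, I.one_mem'⟩
  mem_of_op_mem' := by
    rintro x y ⟨I, hI, hx⟩ ⟨J, hJ, hxy⟩
    rcases hc.total hI hJ with h | h
    · exact ⟨J, hJ, J.mem_of_op_mem' (h hx) hxy⟩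
    · exact ⟨I, hI, I.mem_of_op_mem' hx (h hxy)⟩
  op_op_mem' := fun y ⟨I, hI, hx⟩ => ⟨I, hI, I.op_op_mem' y hx⟩
  op_mem' := fun y ⟨I, hI, hx⟩ => ⟨I, hI, I.op_mem' y hx⟩
  op_op_mem_left' := fun y ⟨I, hI, hx⟩ => ⟨I, hI, I.op_op_mem_left' y hx⟩

theorem exists_isMaximalAvoiding {x : X} (I : LIdeal X) (hI : x ∉ I) :
    ∃ P : LIdeal X, IsMaximalAvoiding x P := by
  obtain ⟨P, -, hP⟩ := zorn_le_nonempty₀ {I : LIdeal X | x ∉ I}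
    (fun c hcs hc J hJ => ⟨chainUnion c hc ⟨J, hJ⟩, fun ⟨K, hK, hx⟩ => hcs hK hx,
      fun K hK _ hy => ⟨K, hK, hy⟩⟩) I hI
  exact ⟨P, hP⟩

/-- By maximality `I ⊔ P` contains `q`, and `q ∉ P`. -/
theorem IsMaximalAvoiding.mem_of_not_le {q : X} (hq : IsQuasiPrime q) {P I : LIdeal X}
    (hP : IsMaximalAvoiding q P) (hI : ¬I ≤ P) : q ∈ I := by
  by_contra hqI
  refine hI (le_sup_left.trans (hP.2 (y := I ⊔ P) (fun h => ?_) le_sup_right))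
  exact (hq.2 I P h).elim hqI hP.1

theorem IsMaximalAvoiding.isPrime {q : X} (hq : IsQuasiPrime q) {P : LIdeal X}
    (hP : IsMaximalAvoiding q P) : P.IsPrime := by
  refine ⟨lt_top_iff_ne_top.2 fun h => hP.1 (h ▸ trivial : q ∈ P), fun I => ?_⟩
  refine or_iff_not_imp_left.2 fun hI x hx => ?_
  by_contra hxP
  -- Neither `span x` nor `I` lies below `P`, so `q` is in their meet, hence in `P`.
  exact hP.1 (hx ⟨hP.mem_of_not_le hq fun h => hxP (h (mem_span_self x)),
    hP.mem_of_not_le hq hI⟩)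

theorem existsUnique_isMaximalAvoiding {q : X} (hq : IsQuasiPrime q) :
    ∃! P : LIdeal X, IsMaximalAvoiding q P := by
  -- Equality as the congruence yields the ideal `{1}`, the starting point for Zorn.
  have hbot : q ∉ LIdeal.ofCongruence (X := X) Eq eq_equivalence
      (fun _ h => h ▸ rfl) (fun _ h => h ▸ rfl) := hq.1.ne
  obtain ⟨P, hP⟩ := exists_isMaximalAvoiding _ hbot
  refine ⟨P, hP, fun Q hQ => le_antisymm ?_ ?_⟩
  · by_contra h
    exact hQ.1 (hP.mem_of_not_le hq h)
  · by_contra h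
    exact hP.1 (hQ.mem_of_not_le hq h)

end LIdeal

theorem proposition4 {X : Type u} [LAlgebra X] (p : X) (hp : LAlgebra.IsPrimeElement p) :
    LAlgebra.IsQuasiPrime p ∧
      (∃! P : LIdeal X, LIdeal.IsMaximalAvoiding p P) ∧
      (∀ P : LIdeal X, LIdeal.IsMaximalAvoiding p P → P.IsPrime) :=
  ⟨hp.isQuasiPrime, LIdeal.existsUnique_isMaximalAvoiding hp.isQuasiPrime,
    fun _ hP => hP.isPrime hp.isQuasiPrime⟩
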